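/- Let $f_1, f_2, f_3, f_4\colon [0,1] \to \mathbb{R}$ be continuous functions. Then there are points $0 \le t_1 \le t_2 \le t_3 \le t_4 \le 1$ such that $$2f_k(t_1)+2f_k(t_3)+f_k(1) = 2f_k(t_2)+2f_k(t_4)+f_k(0) \qquad \text{for all } k \in \{1,2,3,4\}.$$ -/

import Mathlib

/-!
The equation says that, for the path `f = (f₁, …, f₄)`, the increments over the five intervals cut
out by `t₁ ≤ t₂ ≤ t₃ ≤ t₄`, taken with alternating signs, add up to zero: this is the Hobby–Rice
theorem for continuous functions. Write `V(t)` for that signed sum. It makes sense for any number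
`k` of cut points, and it has three symmetries: putting a cut point at `0` changes the sign of
`V`, putting one at `1` leaves `V` unchanged, and so does adding or removing a pair of equal cut
points. So the simplices `{t₁ ≤ … ≤ t_k}` play the role of the hemispheres in the Borsuk–Ulam
theorem, with `V` as the odd map, and Ky Fan's proof of Tucker's lemma applies.

By compactness it is enough to make `V` small (`exists_forall_abs_altVar_le`). The cut points range
over a grid, parametrized by the lattice points `u` of the cube `[0, N]ᵏ` through
`tᵢ = max (u₁, …, uᵢ)`. If `V` is nowhere small on the grid, label each lattice point by a
coordinate in which `V` is large, together with its sign there. When the mesh is fine, adjacent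
points never get opposite labels. Triangulate the cube by iterated prisms (`simplices`), and count
modulo 2 the simplices whose labels, sorted by coordinate, alternate in sign. The cochain `fan s`
detecting such simplices with first sign `s` satisfies `δ (fan s) = fan s + fan (!s)`
(`coboundary_fan`), so modulo 2 the count in dimension `k + 1` equals the number of simplices
in the boundary of the `(k + 1)`-cube that `fan true` detects. By the symmetries of `V`, the face `u₁ = 0`
is a copy of the `k`-cube with opposite labels, the face `u_{k+1} = N` is a copy with the same
labels, and on all other faces the labels depend on fewer than `k` coordinates, hence repeat on
every simplex (`sum_fan_eq_zero`). The count is therefore the same in all dimensions. It is `1` in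
dimension `0`, while in the dimension equal to the number of coordinates of `V` it is `0`, as there
are not enough coordinates for distinct labels. This contradiction is `tucker`.
-/

namespace HobbyRice

open List

variable {X Y : Type*}

/-! ### Mod 2 cochains on ordered simplices -/

/-- The simplicial coboundary modulo 2: the sum of `φ` over the facets of `l`, that is, over the
lists obtained from `l` by deleting one entry. A simplex is given by the list of its vertices, and
the empty list counts as the facet of a single vertex. -/
def coboundary : (List X → ZMod 2) → List X → ZMod 2
  | _, [] => 0
  | φ, x :: l => φ l + coboundary (fun m => φ (x :: m)) l

lemma coboundary_congr {φ ψ : List X → ZMod 2} {l : List X} (h : ∀ m, m <+ l → φ m = ψ m) :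
    coboundary φ l = coboundary ψ l := by
  induction l generalizing φ ψ with
  | nil => rfl
  | cons x l ih =>
    simp only [coboundary]
    rw [h l (sublist_cons_self x l), ih fun m hm => h _ (hm.cons_cons x)]

lemma coboundary_map (g : X → Y) (φ : List Y → ZMod 2) (l : List X) :
    coboundary φ (l.map g) = coboundary (fun m => φ (m.map g)) l := by
  induction l generalizing φ with
  | nil => rfl
  | cons x l ih => simp [coboundary, ih]

lemma coboundary_add (φ ψ : List X → ZMod 2) (l : List X) :
    coboundary (fun m => φ m + ψ m) l = coboundary φ l + coboundary ψ l := by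
  induction l generalizing φ ψ with
  | nil => simp [coboundary]
  | cons x l ih => simp only [coboundary, ih]; ring

lemma coboundary_zero (l : List X) : coboundary (fun _ => 0) l = 0 := by
  induction l with
  | nil => rfl
  | cons x l ih => simp [coboundary, ih]

/-- The coboundary of a symmetric cochain is symmetric, so it can be computed after sorting the
vertices. -/
lemma coboundary_perm {φ : List X → ZMod 2} (hφ : ∀ a b, a ~ b → φ a = φ b) {l l' : List X}
    (h : l ~ l') : coboundary φ l = coboundary φ l' := by
  induction h generalizing φ with
  | nil => rfl
  | cons x h ih =>
    simp only [coboundary]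
    rw [hφ _ _ h, ih fun a b hab => hφ _ _ (hab.cons x)]
  | swap x y l =>
    simp only [coboundary]
    have : (fun m => φ (y :: x :: m)) = fun m => φ (x :: y :: m) :=
      funext fun m => hφ _ _ (Perm.swap x y m)
    rw [this]; ring
  | trans _ _ ih₁ ih₂ => rw [ih₁ hφ, ih₂ hφ]

/-! ### Ky Fan's alternating cochain -/

/-- The label opposite to `x`. Labels are elements of `ι` with a sign, `true` standing for `+`. -/
def neg {ι : Type*} (x : ι × Bool) : ι × Bool := (x.1, !x.2)

section Labels

variable {ι : Type*}

/-- `alt s l` is `1` if the signs of the labels in `l` alternate, starting with `s`, and `0`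
otherwise. -/
def alt : Bool → List (ι × Bool) → ZMod 2
  | _, [] => 1
  | s, x :: l => if x.2 = s then alt (!s) l else 0

/-- Deleting an entry from a sign sequence leaves an alternating one in an odd number of ways
exactly if the sequence itself alternates, and then it has to be one of the two end entries. With
the sign of the first remaining entry prescribed, one way is left. -/
lemma coboundary_alt (s : Bool) (l : List (ι × Bool)) :
    coboundary (alt s) l = alt s l + alt (!s) l := by
  induction l generalizing s with
  | nil => simp only [coboundary, alt]; decide
  | cons x l ih =>
    by_cases h : x.2 = s
    · have h' : ¬ x.2 = !s := by simp [h]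
      simp only [coboundary, alt, h, if_true, ih, Bool.not_not]
      rw [← h] at *
      simp only [Bool.eq_not_self, if_false]
      linear_combination CharTwo.add_self_eq_zero (alt x.2 l)
    · have h' : x.2 = !s := by cases hx : x.2 <;> cases s <;> simp_all
      have h0 : (fun m => alt s (x :: m)) = fun _ => 0 := funext fun m => if_neg h
      simp only [coboundary, h0, coboundary_zero]
      simp [alt, h']

lemma alt_map_neg (s : Bool) (l : List (ι × Bool)) : alt s (l.map neg) = alt (!s) l := by
  induction l generalizing s with
  | nil => rfl
  | cons x l ih =>
    simp only [map_cons, alt, neg, ih, Bool.not_eq_eq_eq_not]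

variable [LinearOrder ι]

open Classical in
/-- Ky Fan's cochain: `1` if the labels in `l` have distinct elements of `ι` and their signs,
read in increasing order of these elements, alternate starting with `s`; `0` otherwise. -/
noncomputable def fan (s : Bool) (l : List (ι × Bool)) : ZMod 2 :=
  if ∃ l', l' ~ l ∧ l'.Pairwise (fun x y => x.1 < y.1) ∧ alt s l' = 1 then 1 else 0

lemma fan_perm (s : Bool) {l l' : List (ι × Bool)} (h : l ~ l') : fan s l = fan s l' := by
  have : ∀ m, m ~ l ↔ m ~ l' := fun m => ⟨fun hm => hm.trans h, fun hm => hm.trans h.symm⟩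
  unfold fan
  congr 1
  simp only [this]

lemma fan_eq_alt (s : Bool) {l : List (ι × Bool)} (h : l.Pairwise (fun x y => x.1 < y.1)) :
    fan s l = alt s l := by
  have key : ∀ l' : List (ι × Bool), l' ~ l → l'.Pairwise (fun x y => x.1 < y.1) → l' = l := by
    intro l' hp h'
    refine hp.eq_of_pairwise ?_ h' h
    intro a b _ _ hab hba
    exact absurd hba hab.asymm
  rcases (by decide : ∀ z : ZMod 2, z = 0 ∨ z = 1) (alt s l) with h0 | h1
  · rw [fan, if_neg, h0]
    rintro ⟨l', hp, h', ha⟩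
    rw [key l' hp h', h0] at ha
    exact absurd ha (by decide)
  · rw [fan, if_pos ⟨l, Perm.refl l, h, h1⟩, h1]

lemma fan_eq_zero (s : Bool) {l : List (ι × Bool)} (h : ¬ (l.map Prod.fst).Nodup) :
    fan s l = 0 := by
  rw [fan, if_neg]
  rintro ⟨l', hp, h', -⟩
  refine h ((hp.map Prod.fst).nodup_iff.1 ?_)
  exact (pairwise_map.2 h').imp fun hab => ne_of_lt hab

lemma exists_sorted_perm {l : List (ι × Bool)} (h : (l.map Prod.fst).Nodup) :
    ∃ l', l' ~ l ∧ l'.Pairwise (fun x y => x.1 < y.1) := by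
  classical
  let r : ι × Bool → ι × Bool → Prop := fun x y => x.1 ≤ y.1
  have : Std.Total r := ⟨fun x y => le_total x.1 y.1⟩
  have : IsTrans _ r := ⟨fun x y z => le_trans (a := x.1)⟩
  have hp := perm_insertionSort r l
  refine ⟨l.insertionSort r, hp, ?_⟩
  have h1 : (l.insertionSort r).Pairwise r := pairwise_insertionSort r l
  have h2 : (l.insertionSort r).Pairwise (fun x y => x.1 ≠ y.1) :=
    pairwise_map.1 ((hp.map Prod.fst).nodup_iff.2 h)
  exact (h1.and h2).imp fun hab => lt_of_le_of_ne hab.1 hab.2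

lemma fan_map_neg (s : Bool) (l : List (ι × Bool)) : fan s (l.map neg) = fan (!s) l := by
  have e : (l.map neg).map Prod.fst = l.map Prod.fst := by simp [neg, Function.comp_def]
  by_cases h : (l.map Prod.fst).Nodup
  · obtain ⟨l', hp, h'⟩ := exists_sorted_perm h
    rw [← fan_perm s (hp.map neg), ← fan_perm _ hp, fan_eq_alt _ h', fan_eq_alt, alt_map_neg]
    exact pairwise_map.2 h'
  · rw [fan_eq_zero _ h, fan_eq_zero _ (e ▸ h)]

/-- Ky Fan's identity. If `l` has no two opposite labels, then either its labels have distinct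
elements of `ι`, and sorting reduces the claim to `coboundary_alt`, or a label occurs twice, and
then the two facets omitting one of its copies cancel, while all other terms vanish. -/
lemma coboundary_fan (s : Bool) {l : List (ι × Bool)} (hl : ∀ x ∈ l, ∀ y ∈ l, y ≠ neg x) :
    coboundary (fan s) l = fan s l + fan (!s) l := by
  by_cases h : (l.map Prod.fst).Nodup
  · obtain ⟨l', hp, h'⟩ := exists_sorted_perm h
    rw [← fan_perm s hp, ← fan_perm _ hp, fan_eq_alt _ h', fan_eq_alt _ h', ← coboundary_alt,
      coboundary_perm (fun a b => fan_perm s) hp.symm]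
    exact coboundary_congr fun m hm => fan_eq_alt s (h'.sublist hm)
  · rw [fan_eq_zero _ h, fan_eq_zero _ h]
    have hl' : ¬ l.Nodup := fun hn => h <| hn.map_on fun x hx y hy hxy => by
      by_contra hne
      refine hl x hx y hy (Prod.ext hxy.symm ?_)
      have : x.2 ≠ y.2 := fun h2 => hne (Prod.ext hxy h2)
      cases hx2 : x.2 <;> cases hy2 : y.2 <;> simp_all [neg]
    obtain ⟨x, hx⟩ := exists_duplicate_iff_not_nodup.2 hl'
    obtain ⟨m, hm⟩ := (duplicate_iff_sublist.1 hx).exists_perm_append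
    rw [coboundary_perm (fun a b => fan_perm s) hm]
    have h0 : (fun m : List (ι × Bool) => fan s (x :: x :: m)) = fun _ => 0 :=
      funext fun m => fan_eq_zero s (by simp)
    simp only [cons_append, nil_append, coboundary, h0, coboundary_zero]
    linear_combination CharTwo.add_self_eq_zero (fan s (x :: m))

end Labels

/-! ### The triangulated cube and its boundary -/

/-- The simplices of the standard triangulation of the prism `[j, j + 1] × l` over the simplex `l`;
the new coordinate is put in front. -/
def prism (j : ℕ) : List (List ℕ) → List (List (List ℕ))
  | [] => []
  | x :: l => ((j :: x) :: ((j + 1) :: x) :: l.map (cons (j + 1))) ::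
      (prism j l).map (cons (j :: x))

/-- The top-dimensional simplices of the triangulation of the cube `[0, N]ᵏ` by iterated prisms.
Points of the cube are lists of length `k`, simplices are lists of points. -/
def simplices (N : ℕ) : ℕ → List (List (List ℕ))
  | 0 => [[[]]]
  | k + 1 => (range N).flatMap fun j => (simplices N k).flatMap (prism j)

lemma sum_map_add (L : List X) (f g : X → ZMod 2) :
    (L.map fun x => f x + g x).sum = (L.map f).sum + (L.map g).sum :=
  List.sum_map_add

/-- The prism formula `∂P = (bottom) + (top) + P∂`, evaluated on a cochain. -/
lemma sum_prism_coboundary (j : ℕ) (φ : List (List ℕ) → ZMod 2) (l : List (List ℕ)) :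
    ((prism j l).map (coboundary φ)).sum = φ (l.map (cons j)) + φ (l.map (cons (j + 1))) +
      coboundary (fun m => ((prism j m).map φ).sum) l := by
  induction l generalizing φ with
  | nil => simpa [prism, coboundary] using (CharTwo.add_self_eq_zero (φ [])).symm
  | cons x l ih =>
    simp only [prism, map_cons, map_map, sum_cons, coboundary, sum_map_add, ih,
      coboundary_add, coboundary_map, Function.comp_def]
    linear_combination CharTwo.add_self_eq_zero (φ ((j :: x) :: l.map (cons (j + 1))))

lemma prism_map {g g' : List ℕ → List ℕ} (h : ∀ j x, j :: g x = g' (j :: x)) (j : ℕ)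
    (l : List (List ℕ)) : prism j (l.map g) = (prism j l).map (map g') := by
  induction l with
  | nil => rfl
  | cons x l ih => simp [prism, ih, h, Function.comp_def]

lemma sum_simplices_succ (N k : ℕ) (φ : List (List ℕ) → ZMod 2) :
    ((simplices N (k + 1)).map φ).sum =
      ∑ j ∈ Finset.range N, ((simplices N k).map fun l => ((prism j l).map φ).sum).sum := by
  have fm : ∀ {A B : Type} (L : List A) (f : A → List B) (ψ : B → ZMod 2),
      ((L.flatMap f).map ψ).sum = (L.map fun x => ((f x).map ψ).sum).sum := by
    intro A B L f ψ
    induction L with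
    | nil => rfl
    | cons x L ih => simp [ih]
  have rg : ∀ (n : ℕ) (F : ℕ → ZMod 2), ((range n).map F).sum = ∑ j ∈ Finset.range n, F j := by
    intro n F
    induction n with
    | zero => rfl
    | succ n ih => simp [range_succ, Finset.sum_range_succ, ih]
  simp only [simplices, fm, rg]

/-- The boundary of the triangulated `(k + 1)`-cube is the sum of its `2 (k + 1)` faces, each with
the triangulation of the `k`-cube. The two faces in the first coordinate are what remains of the
tops and bottoms of the prisms after telescoping. -/
theorem sum_simplices_coboundary (N k : ℕ) (φ : List (List ℕ) → ZMod 2) :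
    ((simplices N (k + 1)).map (coboundary φ)).sum =
      ∑ a ∈ Finset.range (k + 1),
        (((simplices N k).map fun l => φ (l.map fun u => u.insertIdx a N)).sum +
          ((simplices N k).map fun l => φ (l.map fun u => u.insertIdx a 0)).sum) := by
  have tele : ∀ (n : ℕ) (T : ℕ → ZMod 2),
      ∑ j ∈ Finset.range n, (T j + T (j + 1)) = T n + T 0 := by
    intro n T
    induction n with
    | zero => simpa using (CharTwo.add_self_eq_zero (T 0)).symm
    | succ n ih =>
      rw [Finset.sum_range_succ, ih]
      linear_combination CharTwo.add_self_eq_zero (T n)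
  induction k generalizing φ with
  | zero =>
    rw [sum_simplices_succ]
    simp only [simplices, map_cons, map_nil, sum_cons, sum_nil, sum_prism_coboundary]
    simp only [coboundary, prism, map_nil, sum_nil, add_zero]
    rw [tele N fun j => φ [[j]]]
    simp
  | succ k ih =>
    rw [sum_simplices_succ]
    simp only [sum_prism_coboundary, sum_map_add, ih]
    rw [Finset.sum_add_distrib, tele N fun j => ((simplices N (k + 1)).map
      fun l => φ (l.map (cons j))).sum, Finset.sum_comm, Finset.sum_range_succ' _ (k + 1), add_comm]
    congr 1
    refine Finset.sum_congr rfl fun a _ => ?_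
    rw [sum_simplices_succ, sum_simplices_succ, Finset.sum_add_distrib]
    have h : ∀ c : ℕ, ∀ (j : ℕ) (x : List ℕ), j :: x.insertIdx a c =
      (j :: x).insertIdx (a + 1) c := fun c j x => rfl
    simp only [prism_map (h N), prism_map (h 0), map_map]
    rfl

/-- `v` lies in the unit cube with lowest corner `u`; in particular the two have equal length. -/
def Near (u v : List ℕ) : Prop := Forall₂ (fun a b => a ≤ b ∧ b ≤ a + 1) u v

lemma Near.refl (u : List ℕ) : Near u u := forall₂_same.2 fun _ _ => ⟨le_rfl, Nat.le_succ _⟩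

lemma mem_of_mem_prism {j : ℕ} {l m : List (List ℕ)} (hm : m ∈ prism j l) {u : List ℕ}
    (hu : u ∈ m) : ∃ x ∈ l, u = j :: x ∨ u = (j + 1) :: x := by
  induction l generalizing m with
  | nil => simp [prism] at hm
  | cons x l ih =>
    simp only [prism, mem_cons, mem_map] at hm
    rcases hm with rfl | ⟨m', hm', rfl⟩
    · simp only [mem_cons, mem_map] at hu
      rcases hu with rfl | rfl | ⟨y, hy, rfl⟩
      · exact ⟨x, by simp⟩
      · exact ⟨x, by simp⟩
      · exact ⟨y, by simp [hy]⟩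
    · rcases mem_cons.1 hu with rfl | hu
      · exact ⟨x, by simp⟩
      · obtain ⟨y, hy, h⟩ := ih hm' hu
        exact ⟨y, by simp [hy], h⟩

lemma length_of_mem_prism {j : ℕ} {l m : List (List ℕ)} (hm : m ∈ prism j l) :
    m.length = l.length + 1 := by
  induction l generalizing m with
  | nil => simp [prism] at hm
  | cons x l ih =>
    simp only [prism, mem_cons, mem_map] at hm
    rcases hm with rfl | ⟨m', hm', rfl⟩
    · simp
    · simp [ih hm']

lemma pairwise_of_mem_prism {j : ℕ} {l m : List (List ℕ)} (hl : l.Pairwise Near)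
    (hm : m ∈ prism j l) : m.Pairwise Near := by
  induction l generalizing m with
  | nil => simp [prism] at hm
  | cons x l ih =>
    rw [pairwise_cons] at hl
    simp only [prism, mem_cons, mem_map] at hm
    rcases hm with rfl | ⟨m', hm', rfl⟩
    · simp only [pairwise_cons, mem_cons, mem_map, pairwise_map]
      refine ⟨?_, ?_, hl.2.imp fun h => .cons (by omega) h⟩
      · rintro u (rfl | ⟨y, hy, rfl⟩)
        · exact .cons (by omega) (Near.refl x)
        · exact .cons (by omega) (hl.1 y hy)
      · rintro u ⟨y, hy, rfl⟩
        exact .cons (by omega) (hl.1 y hy)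
    · refine pairwise_cons.2 ⟨fun u hu => ?_, ih hl.2 hm'⟩
      obtain ⟨y, hy, rfl | rfl⟩ := mem_of_mem_prism hm' hu
      · exact .cons (by omega) (hl.1 y hy)
      · exact .cons (by omega) (hl.1 y hy)

lemma mem_simplices {N k : ℕ} {m : List (List ℕ)} (hm : m ∈ simplices N k) :
    m.length = k + 1 ∧ m.Pairwise Near ∧ ∀ u ∈ m, u.length = k ∧ ∀ i ∈ u, i ≤ N := by
  induction k generalizing m with
  | zero =>
    obtain rfl : m = [[]] := by simpa [simplices] using hm
    simp
  | succ k ih =>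
    simp only [simplices, mem_flatMap, mem_range] at hm
    obtain ⟨j, hj, l, hl, hm⟩ := hm
    obtain ⟨h1, h2, h3⟩ := ih hl
    refine ⟨by rw [length_of_mem_prism hm, h1], pairwise_of_mem_prism h2 hm, fun u hu => ?_⟩
    obtain ⟨x, hx, rfl | rfl⟩ := mem_of_mem_prism hm hu
    · refine ⟨by simp [h3 x hx], ?_⟩
      simp only [mem_cons, forall_eq_or_imp]
      exact ⟨hj.le, (h3 x hx).2⟩
    · refine ⟨by simp [h3 x hx], ?_⟩
      simp only [mem_cons, forall_eq_or_imp]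
      exact ⟨hj, (h3 x hx).2⟩

lemma Near.sum_le {u v : List ℕ} (h : Near u v) :
    u.sum ≤ v.sum ∧ v.sum ≤ u.sum + u.length ∧ (u.sum = v.sum → u = v) := by
  induction h with
  | nil => simp
  | @cons a b u v hab _ ih =>
    obtain ⟨h1, h2, h3⟩ := ih
    simp only [sum_cons, length_cons]
    refine ⟨by omega, by omega, fun h => ?_⟩
    rw [h3 (by omega), show a = b by omega]

/-- Along the vertices of a simplex the sum of the `k` coordinates does not decrease, it increases
by at most `k` in total, and it determines the vertex; so there are at most `k + 1` of them. -/
lemma length_le_of_nodup {k : ℕ} {l : List (List ℕ)} (hl : l.Pairwise Near)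
    (hk : ∀ u ∈ l, u.length ≤ k) (hn : l.Nodup) : l.length ≤ k + 1 := by
  cases l with
  | nil => simp
  | cons x l =>
    have h1 : ((x :: l).map List.sum).Nodup := by
      refine pairwise_map.2 ((hl.and hn).imp fun {u v} h hs => h.2 (h.1.sum_le.2.2 hs))
    have h2 : ((x :: l).map List.sum).toFinset ⊆ Finset.Icc x.sum (x.sum + k) := by
      intro s hs
      simp only [mem_toFinset, mem_map] at hs
      obtain ⟨u, hu, rfl⟩ := hs
      have hxu : Near x u := by
        rcases mem_cons.1 hu with rfl | hu
        · exact Near.refl u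
        · exact (pairwise_cons.1 hl).1 u hu
      have := hxu.sum_le
      exact Finset.mem_Icc.2 ⟨this.1, this.2.1.trans (Nat.add_le_add_left (hk x (by simp)) _)⟩
    have h3 := Finset.card_le_card h2
    rw [toFinset_card_of_nodup h1] at h3
    simp only [length_map, Nat.card_Icc] at h3
    omega

/-- Replaces the entries in positions `n` and `n + 1` by their maximum; if `n` is the last
position, its entry is dropped. -/
def mergeAt : ℕ → List ℕ → List ℕ
  | 0, a :: b :: l => max a b :: l
  | 0, _ => []
  | n + 1, a :: l => a :: mergeAt n l
  | _ + 1, [] => []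

lemma length_mergeAt {n : ℕ} {l : List ℕ} (h : n < l.length) :
    (mergeAt n l).length + 1 = l.length := by
  induction n generalizing l with
  | zero =>
    match l, h with
    | [a], _ => rfl
    | a :: b :: l, _ => rfl
  | succ n ih =>
    match l, h with
    | a :: l, h => simp [mergeAt, ih (Nat.lt_of_succ_lt_succ h)]

lemma Near.mergeAt (n : ℕ) {u v : List ℕ} (h : Near u v) :
    Near (mergeAt n u) (mergeAt n v) := by
  induction n generalizing u v with
  | zero =>
    cases h with
    | nil => exact .nil
    | cons h1 h =>
      cases h with
      | nil => exact .nil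
      | cons h2 h => exact .cons (by omega) h
  | succ n ih =>
    cases h with
    | nil => exact .nil
    | cons h1 h => exact .cons h1 (ih h)

lemma Near.take (n : ℕ) {u v : List ℕ} (h : Near u v) : Near (u.take n) (v.take n) :=
  forall₂_take n h

/-! ### Tucker's lemma -/

section Tucker

variable {ι : Type*} [LinearOrder ι]

/-- If on the image of the `k`-cube under `G` the labels depend only on fewer than `k` coordinates,
given by `F`, then every simplex has a repeated label there, so `fan s` vanishes on it. -/
lemma sum_fan_eq_zero {N k : ℕ} (s : Bool) (Λ : List ℕ → ι × Bool) {G F : List ℕ → List ℕ}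
    (hF : ∀ u v, Near u v → Near (F u) (F v)) (hlen : ∀ u, u.length = k → (F u).length < k)
    (hG : ∀ u, u.length = k → (∀ i ∈ u, i ≤ N) → Λ (G u) = Λ (F u)) :
    ((simplices N k).map fun l => fan s ((l.map G).map Λ)).sum = 0 := by
  refine sum_eq_zero fun z hz => ?_
  obtain ⟨l, hl, rfl⟩ := mem_map.1 hz
  obtain ⟨h1, h2, h3⟩ := mem_simplices hl
  have e : (l.map G).map Λ = (l.map F).map Λ := by
    simp only [map_map]
    exact map_congr_left fun u hu => hG u (h3 u hu).1 (h3 u hu).2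
  rw [e]
  refine fan_eq_zero s fun hn => ?_
  have hnF : (l.map F).Nodup := (hn.of_map _).of_map _
  have hk : 0 < k := by
    obtain ⟨u, hu⟩ := exists_mem_of_length_pos (l := l) (by omega)
    exact (Nat.zero_le _).trans_lt (hlen u (h3 u hu).1)
  have := length_le_of_nodup (k := k - 1) (pairwise_map.2 (h2.imp fun {u v} h => hF u v h))
    (fun u hu => by
      obtain ⟨v, hv, rfl⟩ := mem_map.1 hu
      exact Nat.le_sub_one_of_lt (hlen v (h3 v hv).1)) hnF
  rw [length_map, h1] at this
  omega

/-- Tucker's lemma, for labellings of all the cubes `[0, N]ᵏ` with `k` at most the number of label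
types. The hypotheses identify the face `u₁ = 0` of a cube with a cube of one dimension less up to
the sign of the labels, and the face where the last coordinate is `N` with the same cube, labels
unchanged; they make all other faces degenerate. -/
theorem tucker [Fintype ι] {N : ℕ} (Λ : List ℕ → ι × Bool)
    (hneg : ∀ u : List ℕ, u.length < Fintype.card ι → (∀ i ∈ u, i ≤ N) → Λ (0 :: u) = neg (Λ u))
    (htop : ∀ u : List ℕ, (∀ i ∈ u, i ≤ N) → ∀ a ≤ u.length, Λ (u.insertIdx a N) = Λ (u.take a))
    (hbot : ∀ (u : List ℕ) (a : ℕ), a < u.length →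
      Λ (u.insertIdx (a + 1) 0) = Λ (mergeAt a u)) :
    ∃ u v : List ℕ, u.length = v.length ∧ v.length ≤ Fintype.card ι ∧
      (∀ i ∈ u, i ≤ N) ∧ (∀ i ∈ v, i ≤ N) ∧ Near u v ∧ Λ v = neg (Λ u) := by
  by_contra! H
  have key : ∀ k ≤ Fintype.card ι, ((simplices N k).map fun l =>
      fan true (l.map Λ) + fan false (l.map Λ)).sum = 1 := by
    intro k
    induction k with
    | zero =>
      intro _
      simp only [simplices, map_cons, map_nil, sum_cons, sum_nil]
      rw [fan_eq_alt _ (pairwise_singleton _ _), fan_eq_alt _ (pairwise_singleton _ _)]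
      cases h : (Λ []).2 <;> simp [alt, h]
    | succ k ih =>
      intro hk
      have e : ((simplices N (k + 1)).map fun l => fan true (l.map Λ) + fan false (l.map Λ)) =
          (simplices N (k + 1)).map (coboundary fun m => fan true (m.map Λ)) := by
        refine map_congr_left fun l hl => ?_
        obtain ⟨-, h2, h3⟩ := mem_simplices hl
        rw [← coboundary_map, coboundary_fan true]
        · rfl
        have : Std.Symm fun u v : List ℕ => Near u v ∨ Near v u := ⟨fun _ _ => Or.symm⟩
        have hnear : ∀ u ∈ l, ∀ v ∈ l, Near u v ∨ Near v u := fun u hu v hv =>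
          Pairwise.forall_of_forall (R := fun u v => Near u v ∨ Near v u)
            (fun u _ => Or.inl (Near.refl u)) (h2.imp Or.inl) hu hv
        simp only [mem_map, forall_exists_index, and_imp, forall_apply_eq_imp_iff₂]
        intro u hu v hv huv
        have hu3 := h3 u hu
        have hv3 := h3 v hv
        rcases hnear u hu v hv with h | h
        · exact H u v (by omega) (by omega) hu3.2 hv3.2 h huv
        · refine H v u (by omega) (by omega) hv3.2 hu3.2 h ?_
          rw [huv]; simp [neg]
      -- Split off the two faces that count: `u_{k+1} = N` (index `k`) and `u₁ = 0` (index `0`).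
      rw [e, sum_simplices_coboundary, Finset.sum_add_distrib, Finset.sum_range_succ,
        Finset.sum_range_succ', Finset.sum_eq_zero, Finset.sum_eq_zero, zero_add, zero_add,
        ← sum_map_add, ← ih (by omega)]
      · congr 1
        refine map_congr_left fun l hl => ?_
        obtain ⟨-, -, h3⟩ := mem_simplices hl
        have e1 : (l.map fun u => u.insertIdx k N).map Λ = l.map Λ := by
          rw [map_map]
          refine map_congr_left fun u hu => ?_
          obtain ⟨hu1, hu2⟩ := h3 u hu
          simp only [Function.comp_apply]
          rw [htop u hu2 k hu1.ge, take_of_length_le hu1.le]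
        have e2 : (l.map fun u => u.insertIdx 0 0).map Λ = (l.map Λ).map neg := by
          rw [map_map, map_map]
          refine map_congr_left fun u hu => ?_
          obtain ⟨hu1, hu2⟩ := h3 u hu
          exact hneg u (by omega) hu2
        rw [e1, e2, fan_map_neg]
        rfl
      · intro a ha
        have ha := Finset.mem_range.1 ha
        refine sum_fan_eq_zero true Λ (fun u v => Near.mergeAt a) (fun u hu => ?_)
          fun u hu _ => hbot u a (by omega)
        have := length_mergeAt (n := a) (l := u) (by omega)
        omega
      · intro a ha
        have ha := Finset.mem_range.1 ha
        refine sum_fan_eq_zero true Λ (fun u v => Near.take a) (fun u hu => ?_)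
          fun u hu h => htop u h a (by omega)
        rw [length_take]
        omega
  -- A simplex of dimension `card ι` has `card ι + 1` vertices.
  have h0 : ((simplices N (Fintype.card ι)).map fun l =>
      fan true (l.map Λ) + fan false (l.map Λ)).sum = 0 := by
    refine sum_eq_zero fun z hz => ?_
    obtain ⟨l, hl, rfl⟩ := mem_map.1 hz
    have hn : ¬ ((l.map Λ).map Prod.fst).Nodup := fun hn => by
      have := hn.length_le_card
      rw [length_map, length_map, (mem_simplices hl).1] at this
      omega
    rw [fan_eq_zero _ hn, fan_eq_zero _ hn, add_zero]
  rw [key _ le_rfl] at h0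
  exact one_ne_zero h0

end Tucker

/-! ### Alternating sums of increments on a grid -/

/-- The sum of the increments of `g` over the successive intervals with endpoints `m`,
`max m u₁`, `max m (max u₁ u₂)`, …, `N`, with alternating signs, the first one being `+`. -/
def altVar (g : ℕ → ℝ) (N : ℕ) : ℕ → List ℕ → ℝ
  | m, [] => g N - g m
  | m, u :: l => g (max m u) - g m - altVar g N (max m u) l

section AltVar

variable (g : ℕ → ℝ) {N : ℕ}

lemma altVar_self {l : List ℕ} (hl : ∀ i ∈ l, i ≤ N) : altVar g N N l = 0 := by
  induction l with
  | nil => simp [altVar]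
  | cons u l ih =>
    rw [forall_mem_cons] at hl
    simp [altVar, max_eq_left hl.1, ih hl.2]

/-- After a cut point at `N` all further intervals are trivial. -/
lemma altVar_insertIdx_top {l : List ℕ} (hl : ∀ i ∈ l, i ≤ N) {a : ℕ} (ha : a ≤ l.length) {m : ℕ}
    (hm : m ≤ N) : altVar g N m (l.insertIdx a N) = altVar g N m (l.take a) := by
  induction a generalizing l m with
  | zero => simp [altVar, max_eq_right hm, altVar_self g hl]
  | succ a ih =>
    match l, ha with
    | u :: l, ha =>
      rw [forall_mem_cons] at hl
      simp only [insertIdx_succ_cons, take_succ_cons, altVar]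
      rw [ih hl.2 (Nat.le_of_succ_le_succ ha) (max_le hm hl.1)]

/-- A later entry `0` repeats the previous cut point, and two equal cut points can be dropped. In
terms of `u` this merges the entries on both sides, because the cut points are running maxima. -/
lemma altVar_insertIdx_zero {l : List ℕ} {a : ℕ} (ha : a < l.length) (m : ℕ) :
    altVar g N m (l.insertIdx (a + 1) 0) = altVar g N m (mergeAt a l) := by
  induction a generalizing l m with
  | zero =>
    match l, ha with
    | [u], _ => simp [altVar, mergeAt]
    | u :: v :: l, _ => simp only [insertIdx_succ_cons, insertIdx_zero, altVar, mergeAt, max_assoc,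
        max_eq_left (Nat.zero_le _)]; ring
  | succ a ih =>
    match l, ha with
    | u :: l, ha =>
      simp only [insertIdx_succ_cons (hd := u), mergeAt, altVar]
      rw [ih (Nat.lt_of_succ_lt_succ ha)]

lemma altVar_append_replicate {l : List ℕ} (hl : ∀ i ∈ l, i ≤ N) (n : ℕ) {m : ℕ} (hm : m ≤ N) :
    altVar g N m (l ++ replicate n N) = altVar g N m l := by
  induction l generalizing m with
  | nil =>
    cases n with
    | zero => rfl
    | succ n =>
      have : altVar g N N (replicate n N) = 0 :=
        altVar_self g fun i hi => (eq_of_mem_replicate hi).le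
      simp [replicate_succ, altVar, max_eq_right hm, this]
  | cons u l ih =>
    rw [forall_mem_cons] at hl
    simp [altVar, ih hl.2 (max_le hm hl.1)]

lemma abs_altVar_sub_le {η : ℝ} (hη : ∀ i, |g (i + 1) - g i| ≤ η) {u v : List ℕ} (h : Near u v)
    {m m' : ℕ} (h1 : m ≤ m') (h2 : m' ≤ m + 1) :
    |altVar g N m' v - altVar g N m u| ≤ (2 * u.length + 1) * η := by
  have step : ∀ {i j : ℕ}, i ≤ j → j ≤ i + 1 → |g j - g i| ≤ η := by
    intro i j hij hji
    obtain rfl | rfl : j = i ∨ j = i + 1 := by omega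
    · simpa using (abs_nonneg _).trans (hη 0)
    · exact hη i
  induction h generalizing m m' with
  | nil =>
    have := abs_le.1 (step h1 h2)
    simp only [altVar, length_nil]
    rw [abs_le]
    constructor <;> push_cast <;> linarith
  | @cons a b u v hab _ ih =>
    have i1 := abs_le.1 (step h1 h2)
    have i2 := abs_le.1 (step (i := max m a) (j := max m' b) (by omega) (by omega))
    have i3 := abs_le.1 (ih (m := max m a) (m' := max m' b) (by omega) (by omega))
    simp only [altVar, length_cons]
    push_cast
    rw [abs_le]
    constructor <;> linarith

end AltVar

/-! ### Labels and the discrete Hobby–Rice theorem -/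

section Label

variable {ι : Type*} [Nonempty ι]

/-- A coordinate of `v` of absolute value larger than `ε`, with its sign; a junk value if there is
none. The coordinate depends only on the absolute values, so that `v` and `-v` get the same one. -/
noncomputable def label (ε : ℝ) (v : ι → ℝ) : ι × Bool :=
  (Classical.epsilon fun j => ε < |v j|, decide (0 < v (Classical.epsilon fun j => ε < |v j|)))

lemma label_neg {ε : ℝ} (hε : 0 ≤ ε) {v : ι → ℝ} (h : ∃ j, ε < |v j|) :
    label ε (-v) = neg (label ε v) := by
  have h' := Classical.epsilon_spec h
  simp only [label, neg, Pi.neg_apply, abs_neg]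
  set j := Classical.epsilon fun j => ε < |v j|
  have hj : v j ≠ 0 := abs_pos.1 (hε.trans_lt h')
  congr 1
  rw [← decide_not, decide_eq_decide]
  rcases lt_or_gt_of_ne hj with h | h
  · exact iff_of_true (by linarith) (by linarith)
  · exact iff_of_false (by linarith) (by simpa using h)

lemma lt_abs_sub_of_label_eq_neg {ε : ℝ} {v w : ι → ℝ} (hv : ∃ j, ε < |v j|)
    (hw : ∃ j, ε < |w j|) (h : label ε w = neg (label ε v)) : ∃ j, 2 * ε < |w j - v j| := by
  have hv' := Classical.epsilon_spec hv
  have hw' := Classical.epsilon_spec hw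
  simp only [label, neg, Prod.mk.injEq] at h
  obtain ⟨h1, h2⟩ := h
  rw [h1] at h2 hw'
  set j := Classical.epsilon fun j => ε < |v j|
  refine ⟨j, ?_⟩
  rw [← decide_not, decide_eq_decide] at h2
  rw [lt_abs] at *
  by_cases h : 0 < v j
  · have : ¬ 0 < w j := by tauto
    right
    rcases hv' with _ | _ <;> rcases hw' with _ | _ <;> linarith
  · have : 0 < w j := by tauto
    left
    rcases hv' with _ | _ <;> rcases hw' with _ | _ <;> linarith

end Label

/-- A discrete Hobby–Rice theorem: finitely many functions on `{0, …, N}` with small increments have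
as many common cut points for which all their alternating sums are small. -/
theorem exists_forall_abs_altVar_le {ι : Type*} [Fintype ι] [LinearOrder ι] [Nonempty ι]
    (g : ι → ℕ → ℝ) (N : ℕ) {ε η : ℝ} (hη : ∀ j i, |g j (i + 1) - g j i| ≤ η)
    (hε : (2 * Fintype.card ι + 1) * η ≤ 2 * ε) :
    ∃ u : List ℕ, u.length = Fintype.card ι ∧ (∀ i ∈ u, i ≤ N) ∧
      ∀ j, |altVar (g j) N 0 u| ≤ ε := by
  by_contra! H
  have hη0 : 0 ≤ η := (abs_nonneg _).trans (hη (Classical.arbitrary ι) 0)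
  have hε0 : 0 ≤ ε := by
    have : 0 ≤ (2 * Fintype.card ι + 1) * η := by positivity
    linarith
  have big : ∀ u : List ℕ, u.length ≤ Fintype.card ι → (∀ i ∈ u, i ≤ N) →
      ∃ j, ε < |altVar (g j) N 0 u| := by
    intro u hu hN
    -- Padding with cut points at `N` reduces shorter lists to the full length.
    obtain ⟨j, hj⟩ := H (u ++ replicate (Fintype.card ι - u.length) N) (by simp; omega) (by
      intro i hi
      rcases mem_append.1 hi with hi | hi
      · exact hN i hi
      · exact (eq_of_mem_replicate hi).le)
    exact ⟨j, by rwa [altVar_append_replicate _ hN _ (Nat.zero_le _)] at hj⟩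
  obtain ⟨u, v, huv, hv, huN, hvN, hnear, hlab⟩ := tucker (N := N)
    (fun u => label ε fun j => altVar (g j) N 0 u)
    (fun u hu hN => by
      rw [← label_neg hε0 (big u hu.le hN)]
      congr 1
      funext j
      simp [altVar])
    (fun u hN a ha => by simp only [altVar_insertIdx_top _ hN ha (Nat.zero_le _)])
    (fun u a ha => by simp only [altVar_insertIdx_zero _ ha])
  obtain ⟨j, hj⟩ := lt_abs_sub_of_label_eq_neg (big u (huv ▸ hv) huN) (big v hv hvN) hlab
  have h1 := abs_altVar_sub_le (g j) (N := N) (hη j) hnear (le_refl 0) (Nat.zero_le _)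
  have h2 : (2 * (u.length : ℝ) + 1) * η ≤ (2 * Fintype.card ι + 1) * η := by
    have : (u.length : ℝ) ≤ Fintype.card ι := by exact_mod_cast huv ▸ hv
    gcongr
  linarith

end HobbyRice

/-! ### Passage to the limit -/

open HobbyRice in
theorem corollary2p3 (f : Fin 4 → unitInterval → ℝ) (hf : ∀ k, Continuous (f k)) :
    ∃ t₁ t₂ t₃ t₄ : unitInterval, t₁ ≤ t₂ ∧ t₂ ≤ t₃ ∧ t₃ ≤ t₄ ∧
      ∀ k, 2 * f k t₁ + 2 * f k t₃ + f k 1 = 2 * f k t₂ + 2 * f k t₄ + f k 0 := by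
  let I := unitInterval
  let V : I × I × I × I → Fin 4 → ℝ := fun t k =>
    2 * f k t.1 + 2 * f k t.2.2.1 + f k 1 - (2 * f k t.2.1 + 2 * f k t.2.2.2 + f k 0)
  let K : Set (I × I × I × I) := {t | t.1 ≤ t.2.1 ∧ t.2.1 ≤ t.2.2.1 ∧ t.2.2.1 ≤ t.2.2.2}
  have hV : Continuous V := by fun_prop
  have hK : IsCompact K := by
    refine IsClosed.isCompact ?_
    refine (isClosed_le ?_ ?_).inter ((isClosed_le ?_ ?_).inter (isClosed_le ?_ ?_)) <;> fun_prop
  have hKne : K.Nonempty := ⟨(0, 0, 0, 0), le_rfl, le_rfl, le_rfl⟩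
  obtain ⟨t, ht, hmin⟩ := hK.exists_isMinOn hKne hV.norm.continuousOn
  refine ⟨t.1, t.2.1, t.2.2.1, t.2.2.2, ht.1, ht.2.1, ht.2.2, ?_⟩
  suffices h : V t = 0 from fun k => sub_eq_zero.1 (congrFun h k)
  by_contra hne
  have hpos : 0 < ‖V t‖ := norm_pos_iff.2 hne
  have hunif : ∀ k, UniformContinuous (f k) := fun k =>
    CompactSpace.uniformContinuous_of_continuous (hf k)
  have hη : 0 < ‖V t‖ / 9 := by positivity
  have hδ : ∃ δ > 0, ∀ k (x y : I), dist x y < δ → dist (f k x) (f k y) < ‖V t‖ / 9 := by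
    choose δ hδ h using fun k => Metric.uniformContinuous_iff.1 (hunif k) _ hη
    refine ⟨Finset.univ.inf' Finset.univ_nonempty δ, by simpa using hδ, fun k x y hxy => ?_⟩
    exact h k (hxy.trans_le (Finset.inf'_le _ (Finset.mem_univ k)))
  obtain ⟨δ, hδ0, hδ⟩ := hδ
  obtain ⟨n, hn⟩ := exists_nat_one_div_lt hδ0
  let p : ℕ → I := fun i => Set.projIcc 0 1 zero_le_one ((i : ℝ) / (n + 1))
  have hp : Monotone p := fun i j hij => Set.monotone_projIcc _ (by gcongr)
  have hp0 : p 0 = 0 := by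
    have : p 0 = Set.projIcc 0 1 zero_le_one (0 : ℝ) := by simp [p]
    rw [this, Set.projIcc_left]; rfl
  have hp1 : p (n + 1) = 1 := by
    have : p (n + 1) = Set.projIcc 0 1 zero_le_one (1 : ℝ) := by
      simp only [p]
      congr 1
      push_cast
      exact div_self (by positivity)
    rw [this, Set.projIcc_right]; rfl
  -- A norm at most half the minimum is a contradiction; `9 = 2 * 4 + 1` is the Lipschitz factor of
  -- the alternating sum with four cut points.
  obtain ⟨u, hu, -, h⟩ := exists_forall_abs_altVar_le (fun k i => f k (p i)) (n + 1)
    (ε := ‖V t‖ / 2) (η := ‖V t‖ / 9) (fun k i => by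
      rw [← Real.dist_eq]
      refine (hδ k _ _ (lt_of_le_of_lt ?_ hn)).le
      refine (Set.abs_projIcc_sub_projIcc (zero_le_one (α := ℝ))).trans (le_of_eq ?_)
      rw [← sub_div, abs_div]
      push_cast
      rw [add_sub_cancel_left, abs_one, abs_of_pos (by positivity)])
    (by simp only [Fintype.card_fin]; push_cast; linarith)
  rw [Fintype.card_fin] at hu
  match u, hu with
  | [a, b, c, e], _ =>
    let s : I × I × I × I := (p a, p (max a b), p (max (max a b) c), p (max (max (max a b) c) e))
    have hs : s ∈ K := ⟨hp (le_max_left _ _), hp (le_max_left _ _), hp (le_max_left _ _)⟩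
    have h1 : ‖V t‖ ≤ ‖V s‖ := hmin hs
    have h2 : ‖V s‖ ≤ ‖V t‖ / 2 := by
      refine (pi_norm_le_iff_of_nonneg (by positivity)).2 fun k => ?_
      have h3 := h k
      simp only [altVar, hp0, hp1, Nat.zero_max] at h3
      rw [Real.norm_eq_abs]
      refine le_of_eq_of_le (congrArg abs ?_) h3
      simp only [V, s]
      ring
    linarith
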